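/- Theorem 1 (Conditioning of the least squares for deconvolution). Let $N\ge 0$, $L\ge 1$ and $K\ge 0$ be integers and let $G\in\mathbb{R}^{N\times L}$. Write $\rho=\|G\|$ for the spectral norm of $G$, and $\theta_{\max}=\max_{1\le i\le L}\|Ge_i\|_2$ and $\theta_{\min}=\min_{1\le i\le L}\|Ge_i\|_2$ for its largest and smallest column norms, and assume $\theta_{\min}>0$. Let $\phi_1,\dots,\phi_K\in\{-1,1\}^L$ be random vectors all of whose $KL$ entries are independent and take the values $\pm1$ with probability $1/2$ each, let $D_{\phi_k}$ be the $L\times L$ diagonal matrix with diagonal $\phi_k$, and let $H\in\mathbb{R}^{KN\times L}$ be the matrix obtained by stacking the blocks $GD_{\phi_1},\dots,GD_{\phi_K}$ on top of each other. Let $\delta\in[0,1]$ and $\beta>0$, and suppose that $$K\ \ge\ \frac{\beta+1}{\log 4-1}\,\delta^{-2}\,\frac{\rho^2}{\theta_{\min}^2}\,\log L .$$ Then, with probability at least $1-2L^{-\beta}$, $$\mathrm{cond}(H^{\mathsf T}H)\ \le\ \frac{1+\delta}{1-\delta}\cdot\frac{\theta_{\max}^2}{\theta_{\min}^2}.$$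 Here $\mathrm{cond}(A)=\|A\|\,\|A^{-1}\|$ (spectral norms) is the condition number of a square matrix $A$, equal to $\infty$ if $A$ is singular; $\delta^{-2}$ is read as $\infty$ for $\delta=0$ (with $\infty\cdot 0=0$), and the right-hand side of the last inequality is read as $\infty$ for $\delta=1$. -/

import Mathlib

open MeasureTheory ProbabilityTheory
open scoped ENNReal Matrix Matrix.Norms.L2Operator

noncomputable section

namespace MaskedImaging

/-- The Euclidean norm of the `i`-th column `G eᵢ` of `G`. -/
def colNorm {N L : ℕ} (G : Matrix (Fin N) (Fin L) ℝ) (i : Fin L) : ℝ :=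
  ‖WithLp.toLp 2 (G *ᵥ (Pi.single i 1))‖

/-- The largest column norm of `G` (for `L ≥ 1`). -/
def thetaMax {N L : ℕ} (G : Matrix (Fin N) (Fin L) ℝ) : ℝ := ⨆ i, colNorm G i

/-- The smallest column norm of `G` (for `L ≥ 1`). -/
def thetaMin {N L : ℕ} (G : Matrix (Fin N) (Fin L) ℝ) : ℝ := ⨅ i, colNorm G i

/-- The spectral norm of `G`: its operator norm between Euclidean spaces. -/
def rho {N L : ℕ} (G : Matrix (Fin N) (Fin L) ℝ) : ℝ := ‖G‖

/-- The blocks `G D_{φ₁}, …, G D_{φ_K}`, stacked on top of each other; the row `(k, n)` is the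
`n`-th row of the `k`-th block. -/
def stacked {N L K : ℕ} (G : Matrix (Fin N) (Fin L) ℝ) (φ : Fin K → Fin L → ℝ) :
    Matrix (Fin K × Fin N) (Fin L) ℝ :=
  Matrix.of fun p l => (G * Matrix.diagonal (φ p.1)) p.2 l

open Classical in
/-- The (spectral) condition number `‖A‖ ‖A⁻¹‖` of a square matrix, infinite if `A` is
singular. -/
def condNumber {L : ℕ} (A : Matrix (Fin L) (Fin L) ℝ) : ℝ≥0∞ :=
  if IsUnit A then ENNReal.ofReal (‖A‖ * ‖A⁻¹‖) else ⊤

/-- The Rademacher distribution: `1` and `-1` with probability `1/2` each. -/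
def rademacher : Measure ℝ :=
  (2⁻¹ : ℝ≥0∞) • Measure.dirac (1 : ℝ) + (2⁻¹ : ℝ≥0∞) • Measure.dirac (-1 : ℝ)

end MaskedImaging

end

/-! The matrix `Hᵀ H` is the sum of the independent positive semidefinite matrices
`D_φₖ Gᵀ G D_φₖ`, each of norm at most `ρ²` and each with mean the diagonal matrix of the squared
column norms of `G`. By the Golden–Thompson inequality the trace exponential of an independent sum
is controlled one summand at a time, and on `[0, ρ²]` the exponential lies below its chord. Hence an
eigenvalue of `Hᵀ H` exceeds `(1 + δ) K θ_max²`, or falls below `(1 - δ) K θ_min²`, with probability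
at most `L exp (-(K θ² / ρ²) h(1 ± δ))`, where `h t = t log t + 1 - t`. Finally `h t / (t - 1)²` is
decreasing for `t > 1` and equals `log 4 - 1` at `t = 2`; for `t < 1` already `(t - 1)² / 2` bounds
`h` from below. -/

namespace MatrixChernoff

open Filter Topology InformationTheory
open scoped ComplexOrder MatrixOrder

section LieProductFormula

theorem norm_pow_sub_pow_le {𝔸 : Type*} [NormedRing 𝔸] [NormOneClass 𝔸] {x y : 𝔸} {M : ℝ}
    (hM : 1 ≤ M) (hx : ‖x‖ ≤ M) (hy : ‖y‖ ≤ M) (m : ℕ) :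
    ‖x ^ m - y ^ m‖ ≤ m * M ^ m * ‖x - y‖ := by
  have : 0 ≤ M := zero_le_one.trans hM
  induction m with
  | zero => simp
  | succ m ih =>
    have hym : ‖y ^ m‖ ≤ M ^ (m + 1) :=
      (norm_pow_le y m).trans <| (pow_le_pow_left₀ (norm_nonneg y) hy m).trans <|
        pow_le_pow_right₀ hM m.le_succ
    calc ‖x ^ (m + 1) - y ^ (m + 1)‖ = ‖x * (x ^ m - y ^ m) + (x - y) * y ^ m‖ := by
          rw [pow_succ', pow_succ']; noncomm_ring
      _ ≤ ‖x‖ * ‖x ^ m - y ^ m‖ + ‖x - y‖ * ‖y ^ m‖ :=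
          (norm_add_le _ _).trans (add_le_add (norm_mul_le _ _) (norm_mul_le _ _))
      _ ≤ M * (m * M ^ m * ‖x - y‖) + ‖x - y‖ * M ^ (m + 1) := by gcongr
      _ = (m + 1 : ℕ) * M ^ (m + 1) * ‖x - y‖ := by push_cast; ring

theorem norm_exp_le (𝕂 : Type*) {𝔸 : Type*} [RCLike 𝕂] [NormedRing 𝔸] [NormOneClass 𝔸]
    [NormedAlgebra 𝕂 𝔸] (x : 𝔸) : ‖NormedSpace.exp x‖ ≤ Real.exp ‖x‖ := by
  rw [NormedSpace.exp_eq_tsum 𝕂, Real.exp_eq_exp_ℝ]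
  refine tsum_of_norm_bounded (NormedSpace.exp_series_hasSum_exp' (𝕂 := ℝ) ‖x‖) fun m => ?_
  rw [norm_smul, norm_inv, RCLike.norm_natCast, smul_eq_mul]
  gcongr
  exact norm_pow_le x m

variable {𝕂 𝔸 : Type*} [RCLike 𝕂] [NormedRing 𝔸] [NormedAlgebra 𝕂 𝔸] [CompleteSpace 𝔸]

theorem tendsto_smul_exp_mul_exp_sub_exp_add (a b : 𝔸) :
    Tendsto (fun m : ℕ => (m : 𝕂) • (NormedSpace.exp ((m : 𝕂)⁻¹ • a) *
      NormedSpace.exp ((m : 𝕂)⁻¹ • b) - NormedSpace.exp ((m : 𝕂)⁻¹ • (a + b)))) atTop (𝓝 0) := by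
  have hderiv : HasDerivAt (fun t : 𝕂 => NormedSpace.exp (t • a) * NormedSpace.exp (t • b) -
      NormedSpace.exp (t • (a + b))) 0 0 := by
    refine (((hasDerivAt_exp_smul_const a (0 : 𝕂)).mul (hasDerivAt_exp_smul_const b 0)).sub
      (hasDerivAt_exp_smul_const (a + b) 0)).congr_deriv ?_
    simp
  have hinv : Tendsto (fun m : ℕ => (m : 𝕂)⁻¹) atTop (𝓝[≠] 0) :=
    tendsto_nhdsWithin_iff.2 ⟨tendsto_inv_atTop_nhds_zero_nat,
      (eventually_ne_atTop 0).mono fun m hm => by simpa using hm⟩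
  simpa [Function.comp_def] using hderiv.tendsto_slope_zero.comp hinv

theorem exp_inv_natCast_smul_pow {m : ℕ} (hm : m ≠ 0) (c : 𝔸) :
    NormedSpace.exp ((m : 𝕂)⁻¹ • c) ^ m = NormedSpace.exp c := by
  let : NormedAlgebra ℚ 𝔸 := NormedAlgebra.restrictScalars ℚ 𝕂 𝔸
  rw [← NormedSpace.exp_nsmul, ← Nat.cast_smul_eq_nsmul 𝕂, smul_smul,
    mul_inv_cancel₀ (Nat.cast_ne_zero.2 hm), one_smul]

theorem tendsto_exp_mul_exp_pow [NormOneClass 𝔸] (a b : 𝔸) :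
    Tendsto (fun m : ℕ => (NormedSpace.exp ((m : 𝕂)⁻¹ • a) * NormedSpace.exp ((m : 𝕂)⁻¹ • b)) ^ m)
      atTop (𝓝 (NormedSpace.exp (a + b))) := by
  have hexp (m : ℕ) (c : 𝔸) : ‖NormedSpace.exp ((m : 𝕂)⁻¹ • c)‖ ≤ Real.exp (‖c‖ / m) := by
    refine (norm_exp_le 𝕂 _).trans_eq ?_
    rw [norm_smul, norm_inv, RCLike.norm_natCast, inv_mul_eq_div]
  have hbound : ∀ᶠ m : ℕ in atTop,
      ‖(NormedSpace.exp ((m : 𝕂)⁻¹ • a) * NormedSpace.exp ((m : 𝕂)⁻¹ • b)) ^ m -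
        NormedSpace.exp (a + b)‖ ≤ Real.exp (‖a‖ + ‖b‖) * ‖(m : 𝕂) •
          (NormedSpace.exp ((m : 𝕂)⁻¹ • a) * NormedSpace.exp ((m : 𝕂)⁻¹ • b) -
            NormedSpace.exp ((m : 𝕂)⁻¹ • (a + b)))‖ := by
    filter_upwards [eventually_ne_atTop 0] with m hm
    have hprod : ‖NormedSpace.exp ((m : 𝕂)⁻¹ • a) * NormedSpace.exp ((m : 𝕂)⁻¹ • b)‖ ≤
        Real.exp ((‖a‖ + ‖b‖) / m) := by
      rw [add_div, Real.exp_add]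
      exact (norm_mul_le _ _).trans (by gcongr <;> exact hexp _ _)
    have hsum : ‖NormedSpace.exp ((m : 𝕂)⁻¹ • (a + b))‖ ≤ Real.exp ((‖a‖ + ‖b‖) / m) :=
      (hexp m _).trans (by gcongr; exact norm_add_le a b)
    have hM : Real.exp ((‖a‖ + ‖b‖) / m) ^ m = Real.exp (‖a‖ + ‖b‖) := by
      rw [← Real.exp_nat_mul, mul_div_cancel₀ _ (Nat.cast_ne_zero.2 hm)]
    have h := norm_pow_sub_pow_le (Real.one_le_exp (by positivity)) hprod hsum m
    rw [exp_inv_natCast_smul_pow hm, hM] at h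
    rw [norm_smul, RCLike.norm_natCast]
    linarith
  rw [tendsto_iff_norm_sub_tendsto_zero]
  refine squeeze_zero' (.of_forall fun _ => norm_nonneg _) hbound ?_
  simpa using (tendsto_smul_exp_mul_exp_sub_exp_add (𝕂 := 𝕂) a b).norm.const_mul
    (Real.exp (‖a‖ + ‖b‖))

end LieProductFormula

section GoldenThompson

open RCLike

theorem trace_mul_pow_comm {n R : Type*} [Fintype n] [DecidableEq n] [CommSemiring R]
    (A B : Matrix n n R) (m : ℕ) :
    ((A * B) ^ m).trace = ((B * A) ^ m).trace := by
  cases m with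
  | zero => simp
  | succ m =>
    rw [pow_succ, ← Matrix.mul_assoc, Matrix.trace_mul_comm, ← Matrix.mul_assoc, ← mul_pow_mul,
      Matrix.mul_assoc, ← pow_succ]

variable {n 𝕜 : Type*} [Fintype n] [RCLike 𝕜]

theorem two_mul_re_trace_mul_le (A B : Matrix n n 𝕜) :
    2 * re (A * B).trace ≤ re (A * Aᴴ).trace + re (Bᴴ * B).trace := by
  have h := (RCLike.nonneg_iff.1
    (Matrix.posSemidef_self_mul_conjTranspose (A - Bᴴ)).trace_nonneg).1
  have hconj : re (Bᴴ * Aᴴ).trace = re (A * B).trace := by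
    rw [← Matrix.conjTranspose_mul, Matrix.trace_conjTranspose]
    exact RCLike.conj_re _
  simp only [Matrix.conjTranspose_sub, Matrix.conjTranspose_conjTranspose, Matrix.sub_mul,
    Matrix.mul_sub, Matrix.trace_sub, map_sub, hconj] at h
  linarith

variable [DecidableEq n]

-- The two bounds feed each other: doubling the exponent in the second applies the first to `P * Q`,
-- doubling it in the first applies the second to `Mᴴ * M` and `M * Mᴴ`.
theorem re_trace_pow_two_pow_le (k : ℕ) :
    (∀ M : Matrix n n 𝕜, re (M ^ 2 ^ (k + 1)).trace ≤ re ((M * Mᴴ) ^ 2 ^ k).trace) ∧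
    ∀ P Q : Matrix n n 𝕜, P.IsHermitian → Q.IsHermitian →
      re ((P * Q) ^ 2 ^ k).trace ≤ re (P ^ 2 ^ k * Q ^ 2 ^ k).trace := by
  induction k with
  | zero =>
    refine ⟨fun M => ?_, fun P Q _ _ => by simp⟩
    have h := two_mul_re_trace_mul_le M M
    rw [Matrix.trace_mul_comm Mᴴ M] at h
    rw [zero_add, pow_one, pow_zero, pow_one, sq]
    linarith
  | succ k ih =>
    obtain ⟨ihM, ihPQ⟩ := ih
    refine ⟨fun M => ?_, fun P Q hP hQ => ?_⟩
    · have hP : (Mᴴ * M).IsHermitian := Matrix.isHermitian_conjTranspose_mul_self M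
      have hQ : (M * Mᴴ).IsHermitian := Matrix.isHermitian_mul_conjTranspose_self M
      calc re (M ^ 2 ^ (k + 2)).trace = re ((M ^ 2) ^ 2 ^ (k + 1)).trace := by
            rw [← pow_mul, pow_succ' 2 (k + 1)]
        _ ≤ re ((M ^ 2 * (M ^ 2)ᴴ) ^ 2 ^ k).trace := ihM _
        _ = re (((Mᴴ * M) * (M * Mᴴ)) ^ 2 ^ k).trace := by
            have h := trace_mul_pow_comm (M * M * Mᴴ) Mᴴ (2 ^ k)
            simp only [Matrix.conjTranspose_mul, sq, Matrix.mul_assoc] at h ⊢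
            rw [h]
        _ ≤ re ((Mᴴ * M) ^ 2 ^ k * (M * Mᴴ) ^ 2 ^ k).trace := ihPQ _ _ hP hQ
        _ ≤ re ((M * Mᴴ) ^ 2 ^ (k + 1)).trace := by
            have h := two_mul_re_trace_mul_le ((Mᴴ * M) ^ 2 ^ k) ((M * Mᴴ) ^ 2 ^ k)
            rw [(hP.pow _).eq, (hQ.pow _).eq, ← pow_add, ← pow_add, ← two_mul, ← pow_succ',
              trace_mul_pow_comm Mᴴ M] at h
            linarith
    · calc re ((P * Q) ^ 2 ^ (k + 1)).trace ≤ re ((P * Q * (P * Q)ᴴ) ^ 2 ^ k).trace := ihM _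
        _ = re ((P ^ 2 * Q ^ 2) ^ 2 ^ k).trace := by
            rw [Matrix.conjTranspose_mul, hP.eq, hQ.eq, ← Matrix.mul_assoc, trace_mul_pow_comm]
            simp only [sq, Matrix.mul_assoc]
        _ ≤ re ((P ^ 2) ^ 2 ^ k * (Q ^ 2) ^ 2 ^ k).trace := ihPQ _ _ (hP.pow 2) (hQ.pow 2)
        _ = re (P ^ 2 ^ (k + 1) * Q ^ 2 ^ (k + 1)).trace := by
            rw [← pow_mul, ← pow_mul, ← pow_succ']

theorem re_trace_exp_add_le {A B : Matrix n n 𝕜} (hA : A.IsHermitian) (hB : B.IsHermitian) :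
    re (NormedSpace.exp (A + B)).trace ≤
      re (NormedSpace.exp A * NormedSpace.exp B).trace := by
  cases isEmpty_or_nonempty n
  · simp [Matrix.trace]
  have hherm {C : Matrix n n 𝕜} (hC : C.IsHermitian) (k : ℕ) :
      (NormedSpace.exp (((2 ^ k : ℕ) : 𝕜)⁻¹ • C)).IsHermitian := by
    refine Matrix.IsHermitian.exp ?_
    rw [Matrix.IsHermitian, Matrix.conjTranspose_smul, hC.eq, star_inv₀, star_natCast]
  refine le_of_tendsto ((continuous_re.comp continuous_id.matrix_trace).tendsto _ |>.comp
    ((tendsto_exp_mul_exp_pow (𝕂 := 𝕜) A B).comp (tendsto_pow_atTop_atTop_of_one_lt one_lt_two)))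
    (.of_forall fun k => ?_)
  have h := (re_trace_pow_two_pow_le k).2 _ _ (hherm hA k) (hherm hB k)
  rwa [exp_inv_natCast_smul_pow (by positivity), exp_inv_natCast_smul_pow (by positivity)] at h

end GoldenThompson

section FunctionalCalculus

theorem exp_mul_le_one_add_mul {R x : ℝ} (hx0 : 0 ≤ x) (hxR : x ≤ R) (θ : ℝ) :
    Real.exp (θ * x) ≤ 1 + (Real.exp (θ * R) - 1) / R * x := by
  rcases hx0.eq_or_lt with rfl | hx
  · simp
  have hR : 0 < R := hx.trans_le hxR
  have h := convexOn_exp.2 (Set.mem_univ 0) (Set.mem_univ (θ * R))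
    (sub_nonneg.2 ((div_le_one hR).2 hxR)) (by positivity) (sub_add_cancel 1 (x / R))
  have hchord : (1 - x / R) • (0 : ℝ) + (x / R) • (θ * R) = θ * x := by
    simp only [smul_eq_mul]; field_simp; ring
  rw [hchord, Real.exp_zero] at h
  refine h.trans_eq ?_
  simp only [smul_eq_mul]; field_simp; ring

theorem exp_smul_le_one_add_smul {A : Type*} [NormedRing A] [StarRing A] [NormedAlgebra ℝ A]
    [StarModule ℝ A] [PartialOrder A] [StarOrderedRing A]
    [ContinuousFunctionalCalculus ℝ A IsSelfAdjoint] [NonnegSpectrumClass ℝ A] {a : A} {R : ℝ}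
    (ha0 : 0 ≤ a) (haR : a ≤ algebraMap ℝ A R) (θ : ℝ) :
    NormedSpace.exp (θ • a) ≤ 1 + ((Real.exp (θ * R) - 1) / R) • a := by
  have ha : IsSelfAdjoint a := .of_nonneg ha0
  have hθa : IsSelfAdjoint (θ • a) := .smul (.all θ) ha
  have hspec := (le_algebraMap_iff_spectrum_le (R := ℝ) ha).1 haR
  calc NormedSpace.exp (θ • a) = cfc (fun x => Real.exp (θ * x)) a := by
        rw [← CFC.real_exp_eq_normedSpace_exp hθa, cfc_comp_const_mul θ Real.exp a]
    _ ≤ cfc (fun x => 1 + (Real.exp (θ * R) - 1) / R * x) a :=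
        cfc_mono fun x hx =>
          exp_mul_le_one_add_mul (spectrum_nonneg_of_nonneg ha0 hx) (hspec x hx) θ
    _ = 1 + ((Real.exp (θ * R) - 1) / R) • a := by
        rw [cfc_const_add _ _ a, map_one, cfc_const_mul_id _ a]

theorem exp_mem_spectrum_exp {A : Type*} [NormedRing A] [StarRing A] [NormedAlgebra ℝ A]
    [ContinuousFunctionalCalculus ℝ A IsSelfAdjoint] {a : A} (ha : IsSelfAdjoint a) {x : ℝ}
    (hx : x ∈ spectrum ℝ a) : Real.exp x ∈ spectrum ℝ (NormedSpace.exp a) := by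
  rw [← CFC.real_exp_eq_normedSpace_exp, cfc_map_spectrum (R := ℝ) Real.exp a]
  exact ⟨x, hx, rfl⟩

theorem smul_mem_spectrum_smul {𝕜 A : Type*} [Field 𝕜] [Ring A] [Algebra 𝕜 A] {a : A} {x : 𝕜}
    (hx : x ∈ spectrum 𝕜 a) (θ : 𝕜) : θ * x ∈ spectrum 𝕜 (θ • a) := by
  have : Nontrivial A := not_subsingleton_iff_nontrivial.1 fun _ => by
    simp [spectrum.of_subsingleton] at hx
  rw [spectrum.smul_eq_smul θ a ⟨x, hx⟩]
  exact Set.smul_mem_smul_set hx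

end FunctionalCalculus

section Conditioning

variable {A : Type*} [NormedRing A] [StarRing A] [NormedAlgebra ℝ A]
  [IsometricContinuousFunctionalCalculus ℝ A IsSelfAdjoint]
  [PartialOrder A] [StarOrderedRing A] [NonnegSpectrumClass ℝ A]

theorem norm_le_of_nonneg_of_le_algebraMap {a : A} {M : ℝ} (hM : 0 ≤ M) (ha0 : 0 ≤ a)
    (haM : a ≤ algebraMap ℝ A M) : ‖a‖ ≤ M := by
  have ha : IsSelfAdjoint a := .of_nonneg ha0
  rw [← cfc_id ℝ a]
  refine norm_cfc_le hM fun x hx => ?_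
  rw [id, Real.norm_of_nonneg (spectrum_nonneg_of_nonneg ha0 hx)]
  exact (le_algebraMap_iff_spectrum_le (R := ℝ) ha).1 haM x hx

theorem le_algebraMap_of_norm_le {a : A} {M : ℝ} (ha : IsSelfAdjoint a) (haM : ‖a‖ ≤ M) :
    a ≤ algebraMap ℝ A M :=
  (le_algebraMap_iff_spectrum_le (R := ℝ) ha).2 fun x hx =>
    (le_abs_self x).trans <|
      (IsometricContinuousFunctionalCalculus.norm_spectrum_le a hx ha).trans haM

theorem isUnit_of_algebraMap_le {a : A} {m : ℝ} (hm : 0 < m) (ha : IsSelfAdjoint a)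
    (hma : algebraMap ℝ A m ≤ a) : IsUnit a :=
  spectrum.isUnit_of_zero_notMem ℝ fun h0 =>
    hm.not_ge ((algebraMap_le_iff_le_spectrum (R := ℝ) ha).1 hma 0 h0)

theorem norm_inverse_le_inv {a : A} {m : ℝ} (hm : 0 < m) (ha : IsSelfAdjoint a)
    (hma : algebraMap ℝ A m ≤ a) : ‖Ring.inverse a‖ ≤ m⁻¹ := by
  have hspec := (algebraMap_le_iff_le_spectrum (R := ℝ) ha).1 hma
  have hne : ∀ x ∈ spectrum ℝ a, x ≠ 0 := fun x hx => (hm.trans_le (hspec x hx)).ne'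
  rw [← cfc_id' ℝ a, ← cfc_inv (fun x : ℝ => x) a hne]
  refine norm_cfc_le (by positivity) fun x hx => ?_
  rw [norm_inv, Real.norm_of_nonneg (hm.le.trans (hspec x hx))]
  exact inv_anti₀ hm (hspec x hx)

end Conditioning

section Trace

open RCLike

variable {n 𝕜 : Type*} [Fintype n] [RCLike 𝕜] {A B C : Matrix n n 𝕜}

theorem re_trace_mul_nonneg (hA : 0 ≤ A) (hB : 0 ≤ B) : 0 ≤ re (A * B).trace := by
  classical
  obtain ⟨C, rfl⟩ := CStarAlgebra.nonneg_iff_eq_star_mul_self.1 hB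
  rw [← mul_assoc, Matrix.trace_mul_comm, ← mul_assoc]
  have hconj := Matrix.nonneg_iff_posSemidef.1 (star_right_conjugate_nonneg hA C)
  exact (RCLike.nonneg_iff.1 hconj.trace_nonneg).1

theorem re_trace_mul_le_re_trace_mul (hA : 0 ≤ A) (hBC : B ≤ C) :
    re (A * B).trace ≤ re (A * C).trace := by
  have h := re_trace_mul_nonneg hA (sub_nonneg.2 hBC)
  rwa [mul_sub, Matrix.trace_sub, map_sub, sub_nonneg] at h

variable [DecidableEq n]

theorem le_re_trace_of_mem_spectrum (hA : 0 ≤ A) {x : ℝ} (hx : x ∈ spectrum ℝ A) :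
    x ≤ re A.trace := by
  have hpos : A.PosSemidef := Matrix.nonneg_iff_posSemidef.1 hA
  rw [hpos.isHermitian.spectrum_real_eq_range_eigenvalues] at hx
  obtain ⟨i, rfl⟩ := hx
  rw [hpos.isHermitian.trace_eq_sum_eigenvalues, ← ofReal_sum, ofReal_re]
  exact Finset.single_le_sum (fun j _ => hpos.eigenvalues_nonneg j) (Finset.mem_univ i)

theorem norm_le_re_trace {A : Matrix n n ℝ} (hA : 0 ≤ A) : ‖A‖ ≤ A.trace := by
  have hpos : A.PosSemidef := Matrix.nonneg_iff_posSemidef.1 hA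
  refine norm_le_of_nonneg_of_le_algebraMap hpos.trace_nonneg hA ?_
  exact (le_algebraMap_iff_spectrum_le (R := ℝ) hA.isSelfAdjoint).2 fun x hx =>
    le_re_trace_of_mem_spectrum hA hx

end Trace

theorem isClosed_setOf_nonneg {n 𝕜 : Type*} [Finite n] [RCLike 𝕜] :
    IsClosed {A : Matrix n n 𝕜 | 0 ≤ A} := by
  have := Fintype.ofFinite n
  simp only [Matrix.nonneg_iff_posSemidef, Matrix.posSemidef_iff_dotProduct_mulVec,
    Set.ofPred_and, Set.ofPred_forall]
  refine (isClosed_eq (by fun_prop) continuous_id).inter (isClosed_iInter fun x => ?_)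
  exact isClosed_le continuous_const (by fun_prop)

instance {n 𝕜 : Type*} [Finite n] [RCLike 𝕜] : OrderClosedTopology (Matrix n n 𝕜) :=
  ⟨isClosed_le_of_isClosed_nonneg isClosed_setOf_nonneg⟩

theorem continuous_exp {n : Type*} [Fintype n] [DecidableEq n] :
    Continuous fun A : Matrix n n ℝ => NormedSpace.exp A := by
  let : NormedAlgebra ℚ (Matrix n n ℝ) := .restrictScalars ℚ ℝ _
  exact NormedSpace.exp_continuous

section LaplaceTransform

variable {Ω n : Type*} {mΩ : MeasurableSpace Ω} {P : Measure Ω} [Fintype n] [DecidableEq n]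
  [MeasurableSpace (Matrix n n ℝ)] [BorelSpace (Matrix n n ℝ)]

theorem integrable_trace_mul_of_indepFun {Y Z : Ω → Matrix n n ℝ} (hYZ : IndepFun Y Z P)
    (hY : Integrable Y P) (hZ : Integrable Z P) :
    Integrable (fun ω => (Y ω * Z ω).trace) P :=
  (Matrix.traceLinearMap n ℝ ℝ).toContinuousLinearMap.integrable_comp
    (hYZ.integrable_bilin hY hZ (ContinuousLinearMap.mul ℝ (Matrix n n ℝ)))

theorem integral_trace_mul_of_indepFun {Y Z : Ω → Matrix n n ℝ} (hYZ : IndepFun Y Z P)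
    (hY : Integrable Y P) (hZ : Integrable Z P) :
    ∫ ω, (Y ω * Z ω).trace ∂P = ((∫ ω, Y ω ∂P) * ∫ ω, Z ω ∂P).trace :=
  ((Matrix.traceLinearMap n ℝ ℝ).toContinuousLinearMap.integral_comp_comm
    (hYZ.integrable_bilin hY hZ (ContinuousLinearMap.mul ℝ (Matrix n n ℝ)))).trans
    (congrArg Matrix.trace (hYZ.integral_bilin hY hZ (ContinuousLinearMap.mul ℝ (Matrix n n ℝ))))

theorem integrable_exp_add_of_indepFun {Y Z : Ω → Matrix n n ℝ} (hYZ : IndepFun Y Z P)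
    (hYm : AEMeasurable Y P) (hZm : AEMeasurable Z P)
    (hYherm : ∀ᵐ ω ∂P, IsSelfAdjoint (Y ω)) (hZherm : ∀ᵐ ω ∂P, IsSelfAdjoint (Z ω))
    (hY : Integrable (fun ω => NormedSpace.exp (Y ω)) P)
    (hZ : Integrable (fun ω => NormedSpace.exp (Z ω)) P) :
    Integrable (fun ω => NormedSpace.exp (Y ω + Z ω)) P := by
  have hindep := hYZ.comp continuous_exp.measurable continuous_exp.measurable
  refine (integrable_trace_mul_of_indepFun hindep hY hZ).mono'
    (continuous_exp.comp_aestronglyMeasurable (hYm.add hZm).aestronglyMeasurable) ?_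
  filter_upwards [hYherm, hZherm] with ω hYω hZω
  exact (norm_le_re_trace (hYω.add hZω).exp_nonneg).trans
    (re_trace_exp_add_le hYω hZω)

theorem integral_trace_exp_add_le_of_indepFun {Y Z : Ω → Matrix n n ℝ} (hYZ : IndepFun Y Z P)
    (hYm : AEMeasurable Y P) (hZm : AEMeasurable Z P)
    (hYherm : ∀ᵐ ω ∂P, IsSelfAdjoint (Y ω)) (hZherm : ∀ᵐ ω ∂P, IsSelfAdjoint (Z ω))
    (hY : Integrable (fun ω => NormedSpace.exp (Y ω)) P)
    (hZ : Integrable (fun ω => NormedSpace.exp (Z ω)) P) {b : ℝ}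
    (hZb : ∫ ω, NormedSpace.exp (Z ω) ∂P ≤ algebraMap ℝ _ b) :
    ∫ ω, (NormedSpace.exp (Y ω + Z ω)).trace ∂P ≤
      b * ∫ ω, (NormedSpace.exp (Y ω)).trace ∂P := by
  have hindep := hYZ.comp continuous_exp.measurable continuous_exp.measurable
  have hYnonneg : 0 ≤ ∫ ω, NormedSpace.exp (Y ω) ∂P :=
    integral_nonneg_of_ae (hYherm.mono fun ω hω => hω.exp_nonneg)
  have htrace : ∫ ω, (NormedSpace.exp (Y ω)).trace ∂P = (∫ ω, NormedSpace.exp (Y ω) ∂P).trace :=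
    (Matrix.traceLinearMap n ℝ ℝ).toContinuousLinearMap.integral_comp_comm hY
  calc ∫ ω, (NormedSpace.exp (Y ω + Z ω)).trace ∂P
      ≤ ∫ ω, (NormedSpace.exp (Y ω) * NormedSpace.exp (Z ω)).trace ∂P := by
        refine integral_mono_ae ((Matrix.traceLinearMap n ℝ ℝ).toContinuousLinearMap.integrable_comp
          (integrable_exp_add_of_indepFun hYZ hYm hZm hYherm hZherm hY hZ))
          (integrable_trace_mul_of_indepFun hindep hY hZ) ?_
        filter_upwards [hYherm, hZherm] with ω hYω hZω using re_trace_exp_add_le hYω hZω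
    _ = ((∫ ω, NormedSpace.exp (Y ω) ∂P) * ∫ ω, NormedSpace.exp (Z ω) ∂P).trace :=
        integral_trace_mul_of_indepFun hindep hY hZ
    _ ≤ ((∫ ω, NormedSpace.exp (Y ω) ∂P) * algebraMap ℝ _ b).trace :=
        re_trace_mul_le_re_trace_mul hYnonneg hZb
    _ = b * ∫ ω, (NormedSpace.exp (Y ω)).trace ∂P := by
        rw [htrace, Algebra.algebraMap_eq_smul_one, mul_smul_comm, mul_one, Matrix.trace_smul,
          smul_eq_mul]

variable [IsProbabilityMeasure P] {ι : Type*} {X : ι → Ω → Matrix n n ℝ}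

theorem integrable_exp_sum (hindep : iIndepFun X P) (hX : ∀ k, AEMeasurable (X k) P)
    (hherm : ∀ k, ∀ᵐ ω ∂P, IsSelfAdjoint (X k ω))
    (hexp : ∀ k, Integrable (fun ω => NormedSpace.exp (X k ω)) P) (s : Finset ι) :
    Integrable (fun ω => NormedSpace.exp (∑ k ∈ s, X k ω)) P := by
  classical
  induction s using Finset.induction_on with
  | empty => simp
  | insert k s hk ih =>
    have hsum : ∀ᵐ ω ∂P, IsSelfAdjoint (∑ j ∈ s, X j ω) :=
      ((ae_ball_iff s.countable_toSet).2 fun j _ => hherm j).mono fun ω hω => isSelfAdjoint_sum s hω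
    simp only [Finset.sum_insert hk, add_comm (X k _)]
    exact integrable_exp_add_of_indepFun
      (by simpa only [Finset.sum_fn] using hindep.indepFun_finsetSum_of_notMem₀ hX hk)
      (Finset.aemeasurable_fun_sum s fun j _ => hX j) (hX k) hsum (hherm k) ih (hexp k)

theorem integral_trace_exp_sum_le (hindep : iIndepFun X P) (hX : ∀ k, AEMeasurable (X k) P)
    (hherm : ∀ k, ∀ᵐ ω ∂P, IsSelfAdjoint (X k ω))
    (hexp : ∀ k, Integrable (fun ω => NormedSpace.exp (X k ω)) P) {b : ι → ℝ}
    (hb : ∀ k, ∫ ω, NormedSpace.exp (X k ω) ∂P ≤ algebraMap ℝ _ (Real.exp (b k)))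
    (s : Finset ι) :
    ∫ ω, (NormedSpace.exp (∑ k ∈ s, X k ω)).trace ∂P ≤
      Fintype.card n * Real.exp (∑ k ∈ s, b k) := by
  classical
  induction s using Finset.induction_on with
  | empty => simp
  | insert k s hk ih =>
    have hsum : ∀ᵐ ω ∂P, IsSelfAdjoint (∑ j ∈ s, X j ω) :=
      ((ae_ball_iff s.countable_toSet).2 fun j _ => hherm j).mono fun ω hω => isSelfAdjoint_sum s hω
    simp only [Finset.sum_insert hk, add_comm (X k _)]
    refine (integral_trace_exp_add_le_of_indepFun
      (by simpa only [Finset.sum_fn] using hindep.indepFun_finsetSum_of_notMem₀ hX hk)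
      (Finset.aemeasurable_fun_sum s fun j _ => hX j) (hX k) hsum (hherm k)
      (integrable_exp_sum hindep hX hherm hexp s) (hexp k) (hb k)).trans ?_
    rw [Real.exp_add, mul_left_comm]
    exact mul_le_mul_of_nonneg_left ih (Real.exp_nonneg _)

end LaplaceTransform

section Tail

variable {Ω n : Type*} {mΩ : MeasurableSpace Ω} {P : Measure Ω} [Fintype n] [DecidableEq n]

theorem measureReal_exists_mem_spectrum_le [IsFiniteMeasure P] {Y : Ω → Matrix n n ℝ}
    (hherm : ∀ᵐ ω ∂P, IsSelfAdjoint (Y ω)) (hexp : Integrable (fun ω => NormedSpace.exp (Y ω)) P)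
    (a : ℝ) :
    P.real {ω | ∃ x ∈ spectrum ℝ (Y ω), a ≤ x} ≤
      Real.exp (-a) * ∫ ω, (NormedSpace.exp (Y ω)).trace ∂P := by
  have htrace_nonneg : ∀ᵐ ω ∂P, 0 ≤ (NormedSpace.exp (Y ω)).trace :=
    hherm.mono fun ω hω =>
      (Matrix.nonneg_iff_posSemidef.1 hω.exp_nonneg).trace_nonneg
  have hsub : P.real {ω | ∃ x ∈ spectrum ℝ (Y ω), a ≤ x} ≤
      P.real {ω | Real.exp a ≤ (NormedSpace.exp (Y ω)).trace} := by
    refine ENNReal.toReal_mono (measure_ne_top P _) (measure_mono_ae ?_)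
    filter_upwards [hherm] with ω hω ⟨x, hx, hax⟩
    exact (Real.exp_le_exp.2 hax).trans
      (le_re_trace_of_mem_spectrum hω.exp_nonneg (exp_mem_spectrum_exp hω hx))
  rw [Real.exp_neg, inv_mul_eq_div, le_div_iff₀' (Real.exp_pos a)]
  exact (mul_le_mul_of_nonneg_left hsub (Real.exp_nonneg a)).trans
    (mul_meas_ge_le_integral_of_nonneg htrace_nonneg
      ((Matrix.traceLinearMap n ℝ ℝ).toContinuousLinearMap.integrable_comp hexp) _)

end Tail

section Chernoff

variable {Ω n : Type*} {mΩ : MeasurableSpace Ω} {P : Measure Ω} [Fintype n] [DecidableEq n]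
  {R : ℝ}

theorem integrable_of_nonneg_of_le_algebraMap [IsFiniteMeasure P] {X : Ω → Matrix n n ℝ}
    (hX : AEStronglyMeasurable X P) (hR : 0 ≤ R)
    (hX0 : ∀ᵐ ω ∂P, 0 ≤ X ω) (hXR : ∀ᵐ ω ∂P, X ω ≤ algebraMap ℝ _ R) : Integrable X P := by
  refine .of_bound hX R ?_
  filter_upwards [hX0, hXR] with ω h0 hR' using norm_le_of_nonneg_of_le_algebraMap hR h0 hR'

theorem integrable_exp_smul [IsFiniteMeasure P] {X : Ω → Matrix n n ℝ}
    (hX : AEStronglyMeasurable X P) (hR : 0 ≤ R)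
    (hX0 : ∀ᵐ ω ∂P, 0 ≤ X ω) (hXR : ∀ᵐ ω ∂P, X ω ≤ algebraMap ℝ _ R) (θ : ℝ) :
    Integrable (fun ω => NormedSpace.exp (θ • X ω)) P := by
  have hchord := (integrable_const (1 : Matrix n n ℝ)).add
    ((integrable_of_nonneg_of_le_algebraMap hX hR hX0 hXR).smul ((Real.exp (θ * R) - 1) / R))
  refine ((Matrix.traceLinearMap n ℝ ℝ).toContinuousLinearMap.integrable_comp hchord).mono'
    (continuous_exp.comp_aestronglyMeasurable (hX.const_smul θ)) ?_
  filter_upwards [hX0, hXR] with ω h0 hR'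
  have hself : IsSelfAdjoint (θ • X ω) := .smul (.all θ) (.of_nonneg h0)
  have hle := re_trace_mul_le_re_trace_mul Matrix.PosSemidef.one.nonneg
    (exp_smul_le_one_add_smul h0 hR' θ)
  simp only [one_mul] at hle
  exact (norm_le_re_trace hself.exp_nonneg).trans hle

theorem integral_exp_smul_le [IsProbabilityMeasure P] {X : Ω → Matrix n n ℝ}
    (hX : AEStronglyMeasurable X P) (hR : 0 ≤ R)
    (hX0 : ∀ᵐ ω ∂P, 0 ≤ X ω) (hXR : ∀ᵐ ω ∂P, X ω ≤ algebraMap ℝ _ R) (θ : ℝ) {b : ℝ}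
    (hb : ((Real.exp (θ * R) - 1) / R) • ∫ ω, X ω ∂P ≤ algebraMap ℝ _ b) :
    ∫ ω, NormedSpace.exp (θ • X ω) ∂P ≤ algebraMap ℝ _ (Real.exp b) := by
  have hint : Integrable (fun ω => ((Real.exp (θ * R) - 1) / R) • X ω) P :=
    (integrable_of_nonneg_of_le_algebraMap hX hR hX0 hXR).smul ((Real.exp (θ * R) - 1) / R)
  calc ∫ ω, NormedSpace.exp (θ • X ω) ∂P
      ≤ ∫ ω, (1 + ((Real.exp (θ * R) - 1) / R) • X ω) ∂P := by
        refine integral_mono_ae (integrable_exp_smul hX hR hX0 hXR θ)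
          ((integrable_const _).add hint) ?_
        filter_upwards [hX0, hXR] with ω h0 hR' using exp_smul_le_one_add_smul h0 hR' θ
    _ = 1 + ((Real.exp (θ * R) - 1) / R) • ∫ ω, X ω ∂P := by
        rw [integral_add (integrable_const _) hint, integral_const, probReal_univ,
          one_smul, integral_smul]
    _ ≤ 1 + algebraMap ℝ _ b := by gcongr
    _ = algebraMap ℝ _ (b + 1) := by rw [map_add, map_one, add_comm]
    _ ≤ algebraMap ℝ _ (Real.exp b) := algebraMap_mono _ (Real.add_one_le_exp b)

variable [MeasurableSpace (Matrix n n ℝ)] [BorelSpace (Matrix n n ℝ)] [IsProbabilityMeasure P]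
  {ι : Type*} [Fintype ι] {X : ι → Ω → Matrix n n ℝ} {μ : ι → ℝ}

theorem measureReal_exists_mem_spectrum_sum_le (hindep : iIndepFun X P)
    (hX : ∀ k, AEMeasurable (X k) P) (hR : 0 ≤ R) (hX0 : ∀ k, ∀ᵐ ω ∂P, 0 ≤ X k ω)
    (hXR : ∀ k, ∀ᵐ ω ∂P, X k ω ≤ algebraMap ℝ _ R) (θ : ℝ) {b : ι → ℝ}
    (hb : ∀ k, ((Real.exp (θ * R) - 1) / R) • ∫ ω, X k ω ∂P ≤ algebraMap ℝ _ (b k)) (a : ℝ) :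
    P.real {ω | ∃ y ∈ spectrum ℝ (∑ k, X k ω), a ≤ θ * y} ≤
      Fintype.card n * Real.exp (∑ k, b k - a) := by
  have hself k : ∀ᵐ ω ∂P, IsSelfAdjoint (θ • X k ω) :=
    (hX0 k).mono fun ω h0 => .smul (.all θ) (.of_nonneg h0)
  have hindepθ : iIndepFun (fun k ω => θ • X k ω) P :=
    hindep.comp (fun _ A => θ • A) fun _ => (continuous_const_smul θ).measurable
  have hmeasθ k : AEMeasurable (fun ω => θ • X k ω) P :=
    (continuous_const_smul θ).measurable.comp_aemeasurable (hX k)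
  have hexp k := integrable_exp_smul (hX k).aestronglyMeasurable hR (hX0 k) (hXR k) θ
  have hmean k := integral_exp_smul_le (hX k).aestronglyMeasurable hR (hX0 k) (hXR k) θ (hb k)
  have hsum : ∀ᵐ ω ∂P, IsSelfAdjoint (∑ k, θ • X k ω) :=
    (ae_all_iff.2 hself).mono fun ω hω => isSelfAdjoint_sum _ fun k _ => hω k
  calc P.real {ω | ∃ y ∈ spectrum ℝ (∑ k, X k ω), a ≤ θ * y}
      ≤ P.real {ω | ∃ y ∈ spectrum ℝ (∑ k, θ • X k ω), a ≤ y} := by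
        refine measureReal_mono fun ω ⟨y, hy, hay⟩ => ⟨θ * y, ?_, hay⟩
        rw [← Finset.smul_sum]
        exact smul_mem_spectrum_smul hy θ
    _ ≤ Real.exp (-a) * ∫ ω, (NormedSpace.exp (∑ k, θ • X k ω)).trace ∂P :=
        measureReal_exists_mem_spectrum_le hsum
          (integrable_exp_sum hindepθ hmeasθ hself hexp Finset.univ) a
    _ ≤ Real.exp (-a) * (Fintype.card n * Real.exp (∑ k, b k)) :=
        mul_le_mul_of_nonneg_left
          (integral_trace_exp_sum_le hindepθ hmeasθ hself hexp hmean Finset.univ)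
          (Real.exp_nonneg _)
    _ = Fintype.card n * Real.exp (∑ k, b k - a) := by
        rw [mul_left_comm, ← Real.exp_add, neg_add_eq_sub]

theorem measureReal_not_sum_le_algebraMap_le (hindep : iIndepFun X P)
    (hX : ∀ k, AEMeasurable (X k) P) (hR : 0 < R) (hX0 : ∀ k, ∀ᵐ ω ∂P, 0 ≤ X k ω)
    (hXR : ∀ k, ∀ᵐ ω ∂P, X k ω ≤ algebraMap ℝ _ R)
    (hμ : ∀ k, ∫ ω, X k ω ∂P ≤ algebraMap ℝ _ (μ k)) {δ : ℝ} (hδ : 0 ≤ δ) :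
    P.real {ω | ¬ ∑ k, X k ω ≤ algebraMap ℝ _ ((1 + δ) * ∑ k, μ k)} ≤
      Fintype.card n * Real.exp (-((∑ k, μ k) / R * klFun (1 + δ))) := by
  -- `log (1 + δ) / R` minimises the exponent `((exp (θ * R) - 1) / R - θ * (1 + δ)) * ∑ k, μ k`.
  set θ := Real.log (1 + δ) / R with hθ
  have hθ0 : 0 ≤ θ := div_nonneg (Real.log_nonneg (by linarith)) hR.le
  have hb k : ((Real.exp (θ * R) - 1) / R) • ∫ ω, X k ω ∂P ≤ algebraMap ℝ _ (δ / R * μ k) := by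
    rw [hθ, div_mul_cancel₀ _ hR.ne', Real.exp_log (by linarith), add_sub_cancel_left, map_mul,
      ← Algebra.smul_def]
    exact smul_le_smul_of_nonneg_left (hμ k) (by positivity)
  have hself : ∀ᵐ ω ∂P, IsSelfAdjoint (∑ k, X k ω) := (ae_all_iff.2 hX0).mono fun ω hω =>
    .of_nonneg (Finset.sum_nonneg fun k _ => hω k)
  calc P.real {ω | ¬ ∑ k, X k ω ≤ algebraMap ℝ _ ((1 + δ) * ∑ k, μ k)}
      ≤ P.real {ω | ∃ y ∈ spectrum ℝ (∑ k, X k ω), θ * ((1 + δ) * ∑ k, μ k) ≤ θ * y} := by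
        refine ENNReal.toReal_mono (measure_ne_top P _) (measure_mono_ae ?_)
        filter_upwards [hself] with ω hω hnot
        have hnot' : ¬ ∑ k, X k ω ≤ algebraMap ℝ _ ((1 + δ) * ∑ k, μ k) := hnot
        rw [le_algebraMap_iff_spectrum_le hω] at hnot'
        push Not at hnot'
        obtain ⟨y, hy, hlt⟩ := hnot'
        exact ⟨y, hy, mul_le_mul_of_nonneg_left hlt.le hθ0⟩
    _ ≤ Fintype.card n * Real.exp (∑ k, δ / R * μ k - θ * ((1 + δ) * ∑ k, μ k)) :=
        measureReal_exists_mem_spectrum_sum_le hindep hX hR.le hX0 hXR θ hb _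
    _ = _ := by rw [← Finset.mul_sum, hθ, klFun_apply]; congr 2; ring

theorem measureReal_not_algebraMap_le_sum_le (hindep : iIndepFun X P)
    (hX : ∀ k, AEMeasurable (X k) P) (hR : 0 < R) (hX0 : ∀ k, ∀ᵐ ω ∂P, 0 ≤ X k ω)
    (hXR : ∀ k, ∀ᵐ ω ∂P, X k ω ≤ algebraMap ℝ _ R)
    (hμ : ∀ k, algebraMap ℝ _ (μ k) ≤ ∫ ω, X k ω ∂P) {δ : ℝ} (hδ0 : 0 ≤ δ) (hδ1 : δ < 1) :
    P.real {ω | ¬ algebraMap ℝ _ ((1 - δ) * ∑ k, μ k) ≤ ∑ k, X k ω} ≤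
      Fintype.card n * Real.exp (-((∑ k, μ k) / R * klFun (1 - δ))) := by
  set θ := Real.log (1 - δ) / R with hθ
  have hθ0 : θ ≤ 0 :=
    div_nonpos_of_nonpos_of_nonneg (Real.log_nonpos (by linarith) (by linarith)) hR.le
  have hb k : ((Real.exp (θ * R) - 1) / R) • ∫ ω, X k ω ∂P ≤ algebraMap ℝ _ (-δ / R * μ k) := by
    rw [hθ, div_mul_cancel₀ _ hR.ne', Real.exp_log (by linarith), sub_sub_cancel_left, map_mul,
      ← Algebra.smul_def]
    exact smul_le_smul_of_nonpos_left (hμ k)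
      (div_nonpos_of_nonpos_of_nonneg (neg_nonpos.2 hδ0) hR.le)
  have hself : ∀ᵐ ω ∂P, IsSelfAdjoint (∑ k, X k ω) := (ae_all_iff.2 hX0).mono fun ω hω =>
    .of_nonneg (Finset.sum_nonneg fun k _ => hω k)
  calc P.real {ω | ¬ algebraMap ℝ _ ((1 - δ) * ∑ k, μ k) ≤ ∑ k, X k ω}
      ≤ P.real {ω | ∃ y ∈ spectrum ℝ (∑ k, X k ω), θ * ((1 - δ) * ∑ k, μ k) ≤ θ * y} := by
        refine ENNReal.toReal_mono (measure_ne_top P _) (measure_mono_ae ?_)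
        filter_upwards [hself] with ω hω hnot
        have hnot' : ¬ algebraMap ℝ _ ((1 - δ) * ∑ k, μ k) ≤ ∑ k, X k ω := hnot
        rw [algebraMap_le_iff_le_spectrum hω] at hnot'
        push Not at hnot'
        obtain ⟨y, hy, hlt⟩ := hnot'
        exact ⟨y, hy, mul_le_mul_of_nonpos_left hlt.le hθ0⟩
    _ ≤ Fintype.card n * Real.exp (∑ k, -δ / R * μ k - θ * ((1 - δ) * ∑ k, μ k)) :=
        measureReal_exists_mem_spectrum_sum_le hindep hX hR.le hX0 hXR θ hb _
    _ = _ := by rw [← Finset.mul_sum, hθ, klFun_apply]; congr 2; ring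

end Chernoff

section KLFun

theorem log_four : Real.log 4 = 2 * Real.log 2 := by
  rw [show (4 : ℝ) = 2 ^ 2 by norm_num, Real.log_pow, Nat.cast_ofNat]

theorem log_four_sub_one_pos : 0 < Real.log 4 - 1 := by
  linarith [Real.log_two_gt_d9, log_four]

theorem antitoneOn_klFun_sub_sq_half :
    AntitoneOn (fun t => klFun t - (t - 1) ^ 2 / 2) (Set.Ioi 0) := by
  have hderiv {t : ℝ} (ht : 0 < t) :
      HasDerivAt (fun t => klFun t - (t - 1) ^ 2 / 2) (Real.log t - (t - 1)) t := by
    refine ((hasDerivAt_klFun ht.ne').sub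
      ((((hasDerivAt_id' t).sub_const 1).fun_pow 2).div_const 2)).congr_deriv ?_
    simp
  refine antitoneOn_of_deriv_nonpos (convex_Ioi 0)
    (fun t ht => (hderiv ht).continuousAt.continuousWithinAt) ?_ ?_
  all_goals rw [interior_Ioi]
  · exact fun t ht => (hderiv ht).differentiableAt.differentiableWithinAt
  · intro t ht
    rw [(hderiv ht).deriv]
    exact sub_nonpos.2 (Real.log_le_sub_one_of_pos ht)

theorem antitoneOn_klFun_div_sq : AntitoneOn (fun t => klFun t / (t - 1) ^ 2) (Set.Ioi 1) := by
  have hderiv {t : ℝ} (ht : 1 < t) : HasDerivAt (fun t => klFun t / (t - 1) ^ 2)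
      ((2 * (t - 1) - (t + 1) * Real.log t) / (t - 1) ^ 3) t := by
    have ht1 : t - 1 ≠ 0 := (sub_pos.2 ht).ne'
    refine ((hasDerivAt_klFun (zero_lt_one.trans ht).ne').div
      (((hasDerivAt_id' t).sub_const 1).fun_pow 2) (pow_ne_zero 2 ht1)).congr_deriv ?_
    simp only [klFun_apply]
    field_simp
    ring
  refine antitoneOn_of_deriv_nonpos (convex_Ioi 1)
    (fun t ht => (hderiv ht).continuousAt.continuousWithinAt) ?_ ?_
  all_goals rw [interior_Ioi]
  · exact fun t ht => (hderiv ht).differentiableAt.differentiableWithinAt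
  · intro t (ht : 1 < t)
    rw [(hderiv ht).deriv]
    have hlog := Real.le_log_one_add_of_nonneg (sub_pos.2 ht).le
    rw [div_le_iff₀ (by linarith), add_sub_cancel] at hlog
    exact div_nonpos_of_nonpos_of_nonneg (by linarith) (pow_nonneg (sub_pos.2 ht).le 3)

theorem log_four_sub_one_mul_sq_le_klFun {t : ℝ} (ht0 : 0 < t) (ht2 : t ≤ 2) :
    (Real.log 4 - 1) * (t - 1) ^ 2 ≤ klFun t := by
  rcases le_or_gt t 1 with ht1 | ht1
  · have h := antitoneOn_klFun_sub_sq_half ht0 (Set.mem_Ioi.2 one_pos) ht1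
    simp only [klFun_one, sub_self] at h
    nlinarith [Real.log_two_lt_d9, log_four, sq_nonneg (t - 1)]
  · have h := antitoneOn_klFun_div_sq ht1 (Set.mem_Ioi.2 one_lt_two) ht2
    have htwo : klFun 2 / (2 - 1) ^ 2 = Real.log 4 - 1 := by
      rw [klFun_apply, log_four]; ring
    simp only at h
    rwa [htwo, le_div_iff₀ (by have := sub_pos.2 ht1; positivity)] at h

theorem mul_exp_neg_le_rpow_neg {x β t : ℝ} (hx : 0 < x) (h : (β + 1) * Real.log x ≤ t) :
    x * Real.exp (-t) ≤ x ^ (-β) :=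
  calc x * Real.exp (-t) ≤ x * Real.exp (-((β + 1) * Real.log x)) := by gcongr
    _ = Real.exp (Real.log x) * Real.exp (-((β + 1) * Real.log x)) := by rw [Real.exp_log hx]
    _ = x ^ (-β) := by
        rw [← Real.exp_add, Real.rpow_def_of_pos hx]
        congr 1
        ring

theorem mul_exp_neg_mul_klFun_le_rpow_neg {x β t u : ℝ} (hx : 0 < x) (ht : 0 ≤ t)
    (hu0 : 0 < u) (hu2 : u ≤ 2) (h : (β + 1) * Real.log x ≤ t * ((Real.log 4 - 1) * (u - 1) ^ 2)) :
    x * Real.exp (-(t * klFun u)) ≤ x ^ (-β) :=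
  mul_exp_neg_le_rpow_neg hx <| h.trans <|
    mul_le_mul_of_nonneg_left (log_four_sub_one_mul_sq_le_klFun hu0 hu2) ht

end KLFun

end MatrixChernoff

namespace MaskedImaging

open MatrixChernoff InformationTheory
open scoped ComplexOrder MatrixOrder

section ConditionNumber

theorem condNumber_le_of_algebraMap_le {L : ℕ} {S : Matrix (Fin L) (Fin L) ℝ} {m M : ℝ}
    (hm : 0 < m) (hM : 0 ≤ M) (hmS : algebraMap ℝ _ m ≤ S) (hSM : S ≤ algebraMap ℝ _ M) :
    condNumber S ≤ ENNReal.ofReal (M / m) := by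
  have hS0 : 0 ≤ S := (algebraMap_nonneg _ hm.le).trans hmS
  have hS : IsSelfAdjoint S := .of_nonneg hS0
  rw [condNumber, if_pos (isUnit_of_algebraMap_le hm hS hmS), Matrix.nonsing_inv_eq_ringInverse]
  exact ENNReal.ofReal_le_ofReal <| mul_le_mul (norm_le_of_nonneg_of_le_algebraMap hM hS0 hSM)
    (norm_inverse_le_inv hm hS hmS) (norm_nonneg _) hM

end ConditionNumber

section ColumnNorms

variable {N L : ℕ}

theorem colNorm_sq (G : Matrix (Fin N) (Fin L) ℝ) (i : Fin L) :
    colNorm G i ^ 2 = (Gᵀ * G) i i := by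
  rw [colNorm, EuclideanSpace.real_norm_sq_eq, Matrix.mul_apply]
  simp [sq]

theorem colNorm_le_thetaMax (G : Matrix (Fin N) (Fin L) ℝ) (i : Fin L) :
    colNorm G i ≤ thetaMax G :=
  le_ciSup (Set.finite_range _).bddAbove i

theorem thetaMin_le_colNorm (G : Matrix (Fin N) (Fin L) ℝ) (i : Fin L) :
    thetaMin G ≤ colNorm G i :=
  ciInf_le (Set.finite_range _).bddBelow i

variable {G : Matrix (Fin N) (Fin L) ℝ}

theorem pos_of_thetaMin_pos (hG : 0 < thetaMin G) : 0 < L := by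
  refine Nat.pos_of_ne_zero fun hL => hG.ne' ?_
  subst hL
  exact Real.iInf_of_isEmpty _

theorem thetaMin_le_thetaMax (hG : 0 < thetaMin G) : thetaMin G ≤ thetaMax G :=
  (thetaMin_le_colNorm G ⟨0, pos_of_thetaMin_pos hG⟩).trans (colNorm_le_thetaMax G _)

theorem norm_pos_of_thetaMin_pos (hG : 0 < thetaMin G) : 0 < ‖G‖ := by
  have hcol := hG.trans_le (thetaMin_le_colNorm G ⟨0, pos_of_thetaMin_pos hG⟩)
  refine norm_pos_iff.2 fun h => hcol.ne' ?_
  simp only [colNorm, h, Matrix.zero_mulVec, WithLp.toLp_zero, norm_zero]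

theorem diagonal_le_diagonal {n : Type*} [DecidableEq n] {d e : n → ℝ} (h : d ≤ e) :
    Matrix.diagonal d ≤ Matrix.diagonal e := by
  rw [Matrix.le_iff, Matrix.diagonal_sub]
  exact Matrix.PosSemidef.diagonal fun i => sub_nonneg.2 (h i)

theorem diagonal_colNorm_sq_le (G : Matrix (Fin N) (Fin L) ℝ) :
    Matrix.diagonal (fun i => colNorm G i ^ 2) ≤ algebraMap ℝ _ (thetaMax G ^ 2) :=
  diagonal_le_diagonal fun i =>
    pow_le_pow_left₀ (norm_nonneg _) (colNorm_le_thetaMax G i) 2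

theorem le_diagonal_colNorm_sq (hG : 0 ≤ thetaMin G) :
    algebraMap ℝ _ (thetaMin G ^ 2) ≤ Matrix.diagonal (fun i => colNorm G i ^ 2) :=
  diagonal_le_diagonal fun i => pow_le_pow_left₀ hG (thetaMin_le_colNorm G i) 2

end ColumnNorms

section MaskedGram

variable {m n : Type*} [Fintype m] [Fintype n] [DecidableEq n]

/-- The Gram matrix `D_v Gᵀ G D_v` of the block `G D_v` masked by `v`; `Hᵀ H` is the sum of these
over the masks. -/
def maskedGram (G : Matrix m n ℝ) (v : n → ℝ) : Matrix n n ℝ :=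
  (G * Matrix.diagonal v)ᵀ * (G * Matrix.diagonal v)

theorem transpose_stacked_mul_stacked {N L K : ℕ} (G : Matrix (Fin N) (Fin L) ℝ)
    (φ : Fin K → Fin L → ℝ) : (stacked G φ)ᵀ * stacked G φ = ∑ k, maskedGram G (φ k) := by
  ext i j
  simp only [Matrix.mul_apply, Matrix.sum_apply, maskedGram, Matrix.transpose_apply, stacked,
    Matrix.of_apply, Fintype.sum_prod_type]

theorem maskedGram_apply (G : Matrix m n ℝ) (v : n → ℝ) (i j : n) :
    maskedGram G v i j = v i * v j * (Gᵀ * G) i j := by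
  rw [maskedGram, Matrix.transpose_mul, Matrix.diagonal_transpose, Matrix.mul_assoc,
    Matrix.diagonal_mul, ← Matrix.mul_assoc, Matrix.mul_diagonal]
  ring

theorem maskedGram_nonneg (G : Matrix m n ℝ) (v : n → ℝ) : 0 ≤ maskedGram G v := by
  rw [maskedGram, ← Matrix.conjTranspose_eq_transpose_of_trivial]
  exact (Matrix.posSemidef_conjTranspose_mul_self _).nonneg

theorem maskedGram_le (G : Matrix m n ℝ) {v : n → ℝ} (hv : ‖v‖ ≤ 1) :
    maskedGram G v ≤ algebraMap ℝ _ (‖G‖ ^ 2) := by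
  refine le_algebraMap_of_norm_le (.of_nonneg (maskedGram_nonneg G v)) ?_
  have hblock : ‖G * Matrix.diagonal v‖ ≤ ‖G‖ := by
    refine (Matrix.l2_opNorm_mul _ _).trans ?_
    rw [Matrix.l2_opNorm_diagonal]
    exact mul_le_of_le_one_right (norm_nonneg G) hv
  rw [maskedGram, ← Matrix.conjTranspose_eq_transpose_of_trivial,
    Matrix.l2_opNorm_conjTranspose_mul_self, ← sq]
  gcongr

theorem continuous_maskedGram (G : Matrix m n ℝ) : Continuous (maskedGram G) := by
  unfold maskedGram
  fun_prop

theorem norm_le_one_of_forall_eq_one_or_neg_one {n : Type*} [Fintype n] {v : n → ℝ}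
    (hv : ∀ i, v i = 1 ∨ v i = -1) : ‖v‖ ≤ 1 :=
  (pi_norm_le_iff_of_nonneg zero_le_one).2 fun i => by rcases hv i with h | h <;> simp [h]

end MaskedGram

section SignMask

variable {Ω : Type*} {mΩ : MeasurableSpace Ω} {P : Measure Ω} [IsProbabilityMeasure P]

theorem integrable_maskedGram {m n : Type*} [Fintype m] [Fintype n] [DecidableEq n]
    {G : Matrix m n ℝ} {v : Ω → n → ℝ} (hv : AEMeasurable v P)
    (hsign : ∀ᵐ ω ∂P, ∀ i, v ω i = 1 ∨ v ω i = -1) :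
    Integrable (fun ω => maskedGram G (v ω)) P :=
  integrable_of_nonneg_of_le_algebraMap
    ((continuous_maskedGram G).comp_aestronglyMeasurable hv.aestronglyMeasurable)
    (sq_nonneg ‖G‖) (.of_forall fun ω => maskedGram_nonneg G (v ω))
    (hsign.mono fun _ hω => maskedGram_le G (norm_le_one_of_forall_eq_one_or_neg_one hω))

variable {N L : ℕ} {G : Matrix (Fin N) (Fin L) ℝ}

theorem integral_maskedGram {v : Ω → Fin L → ℝ} (hv : AEMeasurable v P)
    (hsign : ∀ᵐ ω ∂P, ∀ i, v ω i = 1 ∨ v ω i = -1)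
    (huncorr : ∀ i j, i ≠ j → ∫ ω, v ω i * v ω j ∂P = 0) :
    ∫ ω, maskedGram G (v ω) ∂P = Matrix.diagonal fun i => colNorm G i ^ 2 := by
  ext i j
  have hsq : ∀ᵐ ω ∂P, v ω i * v ω i = 1 := by
    filter_upwards [hsign] with ω hω
    rcases hω i with h | h <;> simp [h]
  have hcov : ∫ ω, v ω i * v ω j ∂P = if i = j then 1 else 0 := by
    split_ifs with hij
    · rw [← hij, integral_congr_ae hsq, integral_const, probReal_univ, one_smul]
    · exact huncorr i j hij
  calc (∫ ω, maskedGram G (v ω) ∂P) i j = ∫ ω, maskedGram G (v ω) i j ∂P :=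
        ((Matrix.entryLinearMap ℝ ℝ i j).toContinuousLinearMap.integral_comp_comm
          (integrable_maskedGram hv hsign)).symm
    _ = (if i = j then 1 else 0) * (Gᵀ * G) i j := by
        simp only [maskedGram_apply, integral_mul_const, hcov]
    _ = Matrix.diagonal (fun i => colNorm G i ^ 2) i j := by
        rw [Matrix.diagonal_apply, ite_mul, one_mul, zero_mul]
        split_ifs with hij
        · rw [← hij, colNorm_sq]
        · rfl

variable {K : ℕ} {φ : Fin K → Ω → Fin L → ℝ} {β δ : ℝ}

theorem measureReal_not_sum_maskedGram_le (hφ : ∀ k, AEMeasurable (φ k) P)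
    (hindep : iIndepFun φ P) (hsign : ∀ k, ∀ᵐ ω ∂P, ∀ i, φ k ω i = 1 ∨ φ k ω i = -1)
    (huncorr : ∀ k i j, i ≠ j → ∫ ω, φ k ω i * φ k ω j ∂P = 0)
    (hG : 0 < thetaMin G) (hδ0 : 0 ≤ δ) (hδ1 : δ ≤ 1)
    (hK : (β + 1) * Real.log L ≤ K * thetaMin G ^ 2 / ‖G‖ ^ 2 * ((Real.log 4 - 1) * δ ^ 2)) :
    P.real {ω | ¬ ∑ k, maskedGram G (φ k ω) ≤ algebraMap ℝ _ ((1 + δ) * (K * thetaMax G ^ 2))} ≤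
      (L : ℝ) ^ (-β) := by
  borelize (Matrix (Fin L) (Fin L) ℝ)
  have hGram := (continuous_maskedGram G).measurable
  have htail := measureReal_not_sum_le_algebraMap_le
    (hindep.comp (fun _ => maskedGram G) fun _ => hGram)
    (fun k => hGram.comp_aemeasurable (hφ k)) (pow_pos (norm_pos_of_thetaMin_pos hG) 2)
    (fun k => .of_forall fun ω => maskedGram_nonneg G (φ k ω))
    (fun k => (hsign k).mono fun _ hω =>
      maskedGram_le G (norm_le_one_of_forall_eq_one_or_neg_one hω))
    (fun k => (integral_maskedGram (hφ k) (hsign k) (huncorr k)).trans_le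
      (diagonal_colNorm_sq_le G)) hδ0
  simp only [Finset.sum_const, Finset.card_univ, Fintype.card_fin, nsmul_eq_mul] at htail
  refine htail.trans (mul_exp_neg_mul_klFun_le_rpow_neg
    (Nat.cast_pos.2 (pos_of_thetaMin_pos hG)) (by positivity) (by linarith) (by linarith) ?_)
  rw [add_sub_cancel_left]
  refine hK.trans ?_
  have := log_four_sub_one_pos
  gcongr
  exact thetaMin_le_thetaMax hG

theorem measureReal_not_le_sum_maskedGram (hφ : ∀ k, AEMeasurable (φ k) P)
    (hindep : iIndepFun φ P) (hsign : ∀ k, ∀ᵐ ω ∂P, ∀ i, φ k ω i = 1 ∨ φ k ω i = -1)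
    (huncorr : ∀ k i j, i ≠ j → ∫ ω, φ k ω i * φ k ω j ∂P = 0)
    (hG : 0 < thetaMin G) (hδ0 : 0 ≤ δ) (hδ1 : δ < 1)
    (hK : (β + 1) * Real.log L ≤ K * thetaMin G ^ 2 / ‖G‖ ^ 2 * ((Real.log 4 - 1) * δ ^ 2)) :
    P.real {ω | ¬ algebraMap ℝ _ ((1 - δ) * (K * thetaMin G ^ 2)) ≤ ∑ k, maskedGram G (φ k ω)} ≤
      (L : ℝ) ^ (-β) := by
  borelize (Matrix (Fin L) (Fin L) ℝ)
  have hGram := (continuous_maskedGram G).measurable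
  have htail := measureReal_not_algebraMap_le_sum_le
    (hindep.comp (fun _ => maskedGram G) fun _ => hGram)
    (fun k => hGram.comp_aemeasurable (hφ k)) (pow_pos (norm_pos_of_thetaMin_pos hG) 2)
    (fun k => .of_forall fun ω => maskedGram_nonneg G (φ k ω))
    (fun k => (hsign k).mono fun _ hω =>
      maskedGram_le G (norm_le_one_of_forall_eq_one_or_neg_one hω))
    (fun k => (le_diagonal_colNorm_sq hG.le).trans_eq
      (integral_maskedGram (hφ k) (hsign k) (huncorr k)).symm) hδ0 hδ1
  simp only [Finset.sum_const, Finset.card_univ, Fintype.card_fin, nsmul_eq_mul] at htail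
  refine htail.trans (mul_exp_neg_mul_klFun_le_rpow_neg
    (Nat.cast_pos.2 (pos_of_thetaMin_pos hG)) (by positivity) (by linarith) (by linarith) ?_)
  rwa [sub_sub_cancel_left, neg_sq]

theorem le_measureReal_condNumber_stacked_le (hφ : ∀ k, AEMeasurable (φ k) P)
    (hindep : iIndepFun φ P) (hsign : ∀ k, ∀ᵐ ω ∂P, ∀ i, φ k ω i = 1 ∨ φ k ω i = -1)
    (huncorr : ∀ k i j, i ≠ j → ∫ ω, φ k ω i * φ k ω j ∂P = 0)
    (hG : 0 < thetaMin G) (hδ0 : 0 ≤ δ) (hδ1 : δ < 1) (hK0 : 0 < K)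
    (hK : (β + 1) * Real.log L ≤ K * thetaMin G ^ 2 / ‖G‖ ^ 2 * ((Real.log 4 - 1) * δ ^ 2)) :
    1 - 2 * (L : ℝ) ^ (-β) ≤
      P.real {ω | condNumber ((stacked G fun k => φ k ω)ᵀ * stacked G fun k => φ k ω) ≤
        ENNReal.ofReal ((1 + δ) / (1 - δ) * (thetaMax G ^ 2 / thetaMin G ^ 2))} := by
  set good := {ω | condNumber ((stacked G fun k => φ k ω)ᵀ * stacked G fun k => φ k ω) ≤
    ENNReal.ofReal ((1 + δ) / (1 - δ) * (thetaMax G ^ 2 / thetaMin G ^ 2))}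
  have hupper := measureReal_not_sum_maskedGram_le hφ hindep hsign huncorr hG hδ0 hδ1.le hK
  have hlower := measureReal_not_le_sum_maskedGram hφ hindep hsign huncorr hG hδ0 hδ1 hK
  set upper := {ω | ¬ ∑ k, maskedGram G (φ k ω) ≤ algebraMap ℝ _ ((1 + δ) * (K * thetaMax G ^ 2))}
  set lower := {ω | ¬ algebraMap ℝ _ ((1 - δ) * (K * thetaMin G ^ 2)) ≤ ∑ k, maskedGram G (φ k ω)}
  have : (0 : ℝ) < K := Nat.cast_pos.2 hK0
  have hδ : 0 < 1 - δ := sub_pos.2 hδ1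
  have hcover : (Set.univ : Set Ω) ⊆ good ∪ (upper ∪ lower) := by
    rintro ω -
    by_contra h
    simp only [good, upper, lower, Set.mem_union, Set.mem_ofPred_eq, not_or, not_not] at h
    obtain ⟨hbad, hle, hge⟩ := h
    refine hbad ?_
    rw [transpose_stacked_mul_stacked]
    refine (condNumber_le_of_algebraMap_le (by positivity) (by positivity) hge hle).trans_eq ?_
    congr 1
    field_simp
  calc 1 - 2 * (L : ℝ) ^ (-β) ≤ P.real Set.univ - (P.real upper + P.real lower) := by
        rw [probReal_univ]; linarith
    _ ≤ P.real good := by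
        linarith [measureReal_mono hcover (μ := P), measureReal_union_le (μ := P) upper lower,
          measureReal_union_le (μ := P) good (upper ∪ lower)]

end SignMask

section Independence

variable {Ω : Type*} {mΩ : MeasurableSpace Ω} {P : Measure Ω} [IsProbabilityMeasure P]

theorem iIndepFun_curry {ι κ X : Type*} [Countable ι] [Countable κ] [MeasurableSpace X]
    {Y : ι → κ → Ω → X} (hY : ∀ i j, AEMeasurable (Y i j) P)
    (hindep : iIndepFun (fun p : ι × κ => Y p.1 p.2) P) :
    iIndepFun (fun i ω j => Y i j ω) P := by
  have hmap : ∀ i j, IsProbabilityMeasure (P.map (Y i j)) := fun i j =>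
    Measure.isProbabilityMeasure_map (hY i j)
  have hrow : ∀ i, P.map (fun ω j => Y i j ω) = Measure.infinitePi fun j => P.map (Y i j) :=
    fun i => (hindep.precomp (Prod.mk_right_injective i)).map_fun_eq_infinitePi_map₀' (hY i)
  have hjoint : AEMeasurable (fun ω (p : ι × κ) => Y p.1 p.2 ω) P :=
    aemeasurable_pi_iff.2 fun p => hY p.1 p.2
  rw [iIndepFun_iff_map_fun_eq_infinitePi_map₀' fun i => aemeasurable_pi_iff.2 (hY i)]
  simp only [hrow]
  rw [← Measure.infinitePi_map_curry, ← hindep.map_fun_eq_infinitePi_map₀ hjoint,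
    AEMeasurable.map_map_of_aemeasurable (MeasurableEquiv.measurable _).aemeasurable hjoint]
  rfl

end Independence

section Rademacher

variable {Ω : Type*} {mΩ : MeasurableSpace Ω} {P : Measure Ω} {X Y : Ω → ℝ}

theorem ae_eq_one_or_neg_one_of_hasLaw_rademacher (hX : HasLaw X rademacher P) :
    ∀ᵐ ω ∂P, X ω = 1 ∨ X ω = -1 := by
  have h : ∀ᵐ x ∂rademacher, x = 1 ∨ x = -1 := by
    simp [rademacher, ae_add_measure_iff, ae_dirac_eq]
  exact hX.ae_iff (by measurability) |>.2 h

theorem integral_eq_zero_of_hasLaw_rademacher (hX : HasLaw X rademacher P) :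
    ∫ ω, X ω ∂P = 0 := by
  rw [hX.integral_eq, rademacher, integral_add_measure]
  all_goals simp [integrable_dirac, Integrable.smul_measure]

theorem integral_mul_eq_zero_of_hasLaw_rademacher (hX : HasLaw X rademacher P)
    (hY : AEStronglyMeasurable Y P) (hXY : IndepFun X Y P) : ∫ ω, X ω * Y ω ∂P = 0 := by
  rw [hXY.integral_fun_mul_eq_mul_integral hX.aemeasurable.aestronglyMeasurable hY,
    integral_eq_zero_of_hasLaw_rademacher hX, zero_mul]

end Rademacher

section SampleSize

theorem one_lt_and_pos_of_rpow_neg_lt_one {n : ℕ} (hn : 0 < n) {b : ℝ}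
    (h : (n : ℝ) ^ (-b) < 1) : 1 < n ∧ 0 < b := by
  rcases (Real.rpow_lt_one_iff_of_pos (Nat.cast_pos.2 hn)).1 h with ⟨hn1, hb⟩ | ⟨hn1, -⟩
  · exact ⟨Nat.one_lt_cast.1 hn1, neg_neg_iff_pos.1 hb⟩
  · exact absurd hn1 (Nat.one_le_cast.2 hn).not_gt

theorem pos_and_mul_le_of_ofReal_mul_inv_le {a d r l x : ℝ} (ha : 0 < a) (hd : 0 ≤ d)
    (hr : 0 < r) (hl : 0 < l) (hx : 0 ≤ x)
    (h : ENNReal.ofReal a * (ENNReal.ofReal d)⁻¹ * ENNReal.ofReal r * ENNReal.ofReal l ≤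
      ENNReal.ofReal x) : 0 < d ∧ a * r * l ≤ x * d := by
  rcases hd.eq_or_lt with rfl | hd
  · have hpos : ∀ {y : ℝ}, 0 < y → ENNReal.ofReal y ≠ 0 := fun hy =>
      (ENNReal.ofReal_pos.2 hy).ne'
    rw [ENNReal.ofReal_zero, ENNReal.inv_zero, ENNReal.mul_top (hpos ha), ENNReal.top_mul (hpos hr),
      ENNReal.top_mul (hpos hl), top_le_iff] at h
    exact absurd h ENNReal.ofReal_ne_top
  · rw [← ENNReal.ofReal_inv_of_pos hd, ← ENNReal.ofReal_mul ha.le,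
      ← ENNReal.ofReal_mul (by positivity), ← ENNReal.ofReal_mul (by positivity),
      ENNReal.ofReal_le_ofReal_iff hx] at h
    refine ⟨hd, ?_⟩
    calc a * r * l = a * d⁻¹ * r * l * d := by field_simp
      _ ≤ x * d := by gcongr

theorem ofReal_div_ofReal_one_sub_self_mul {a b : ℝ} (ha : 0 < a) (hb : 0 < b) :
    ENNReal.ofReal a / ENNReal.ofReal (1 - 1) * ENNReal.ofReal b = ⊤ := by
  rw [sub_self, ENNReal.ofReal_zero, ENNReal.div_zero (ENNReal.ofReal_pos.2 ha).ne',
    ENNReal.top_mul (ENNReal.ofReal_pos.2 hb).ne']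

theorem pos_and_mul_log_le_of_ofReal_le_natCast {N L K : ℕ} {G : Matrix (Fin N) (Fin L) ℝ}
    (hG : 0 < thetaMin G) (hL : 1 < L) {β δ : ℝ} (hβ : 0 < β)
    (hK : ENNReal.ofReal ((β + 1) / (Real.log 4 - 1)) * (ENNReal.ofReal (δ ^ 2))⁻¹ *
        ENNReal.ofReal (‖G‖ ^ 2 / thetaMin G ^ 2) * ENNReal.ofReal (Real.log L) ≤ (K : ℝ≥0∞)) :
    0 < K ∧
      (β + 1) * Real.log L ≤ K * thetaMin G ^ 2 / ‖G‖ ^ 2 * ((Real.log 4 - 1) * δ ^ 2) := by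
  have hρ : 0 < ‖G‖ := norm_pos_of_thetaMin_pos hG
  have hc := log_four_sub_one_pos
  have hlog : 0 < Real.log L := Real.log_pos (Nat.one_lt_cast.2 hL)
  rw [← ENNReal.ofReal_natCast] at hK
  obtain ⟨hδ, hle⟩ := pos_and_mul_le_of_ofReal_mul_inv_le (by positivity) (sq_nonneg δ)
    (by positivity) hlog K.cast_nonneg hK
  constructor
  · have hKδ : 0 < K * δ ^ 2 := lt_of_lt_of_le (by positivity) hle
    exact Nat.cast_pos.1 (pos_of_mul_pos_left hKδ hδ.le)
  · calc (β + 1) * Real.log L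
        = (β + 1) / (Real.log 4 - 1) * (‖G‖ ^ 2 / thetaMin G ^ 2) * Real.log L *
            (thetaMin G ^ 2 / ‖G‖ ^ 2 * (Real.log 4 - 1)) := by field_simp
      _ ≤ K * δ ^ 2 * (thetaMin G ^ 2 / ‖G‖ ^ 2 * (Real.log 4 - 1)) := by gcongr
      _ = K * thetaMin G ^ 2 / ‖G‖ ^ 2 * ((Real.log 4 - 1) * δ ^ 2) := by ring

end SampleSize

end MaskedImaging

open MaskedImaging in
theorem theorem1_general {Ω : Type*} [MeasurableSpace Ω] {P : Measure Ω} [IsProbabilityMeasure P]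
    {N L K : ℕ} {G : Matrix (Fin N) (Fin L) ℝ} (hG : 0 < thetaMin G)
    {φ : Fin K → Ω → Fin L → ℝ} (hφ : ∀ k, AEMeasurable (φ k) P) (hindep : iIndepFun φ P)
    (hsign : ∀ k, ∀ᵐ ω ∂P, ∀ i, φ k ω i = 1 ∨ φ k ω i = -1)
    (huncorr : ∀ k i j, i ≠ j → ∫ ω, φ k ω i * φ k ω j ∂P = 0)
    {δ β : ℝ} (hδ : δ ∈ Set.Icc (0 : ℝ) 1)
    (hK : ENNReal.ofReal ((β + 1) / (Real.log 4 - 1)) * (ENNReal.ofReal (δ ^ 2))⁻¹ *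
        ENNReal.ofReal (rho G ^ 2 / thetaMin G ^ 2) * ENNReal.ofReal (Real.log L) ≤ (K : ℝ≥0∞)) :
    1 - 2 * (L : ℝ) ^ (-β) ≤
      P.real {ω | condNumber ((stacked G fun k => φ k ω)ᵀ * stacked G fun k => φ k ω) ≤
        ENNReal.ofReal (1 + δ) / ENNReal.ofReal (1 - δ) *
          ENNReal.ofReal (thetaMax G ^ 2 / thetaMin G ^ 2)} := by
  have hmax : 0 < thetaMax G := hG.trans_le (thetaMin_le_thetaMax hG)
  rcases le_or_gt 1 (2 * (L : ℝ) ^ (-β)) with htrivial | hlt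
  · exact (sub_nonpos.2 htrivial).trans measureReal_nonneg
  obtain ⟨hL, hβ⟩ := one_lt_and_pos_of_rpow_neg_lt_one (pos_of_thetaMin_pos hG)
    (show (L : ℝ) ^ (-β) < 1 by linarith)
  obtain ⟨hK0, hKδ⟩ := pos_and_mul_log_le_of_ofReal_le_natCast hG hL hβ hK
  rcases hδ.2.eq_or_lt with rfl | hδ1
  · simp only [ofReal_div_ofReal_one_sub_self_mul (show (0 : ℝ) < 1 + 1 by norm_num)
      (show 0 < thetaMax G ^ 2 / thetaMin G ^ 2 by positivity), le_top, Set.ofPred_true,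
      probReal_univ]
    linarith [Real.rpow_nonneg (Nat.cast_nonneg (α := ℝ) L) (-β)]
  · rw [← ENNReal.ofReal_div_of_pos (sub_pos.2 hδ1),
      ← ENNReal.ofReal_mul (div_nonneg (by linarith [hδ.1]) (sub_nonneg.2 hδ1.le))]
    exact le_measureReal_condNumber_stacked_le hφ hindep hsign huncorr hG hδ.1 hδ1 hK0 hKδ

theorem theorem1 {Ω : Type*} [MeasurableSpace Ω] (P : Measure Ω) [IsProbabilityMeasure P]
    (N L K : ℕ) (hL : 1 ≤ L)
    (G : Matrix (Fin N) (Fin L) ℝ) (hG : 0 < MaskedImaging.thetaMin G)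
    (φ : Fin K → Ω → Fin L → ℝ)
    (hφ_law : ∀ k l, HasLaw (fun ω => φ k ω l) MaskedImaging.rademacher P)
    (hφ_indep : iIndepFun (fun (p : Fin K × Fin L) ω => φ p.1 ω p.2) P)
    (δ β : ℝ) (hδ : δ ∈ Set.Icc (0 : ℝ) 1) (hβ : 0 < β)
    (hK : ENNReal.ofReal ((β + 1) / (Real.log 4 - 1)) * (ENNReal.ofReal (δ ^ 2))⁻¹ *
        ENNReal.ofReal (MaskedImaging.rho G ^ 2 / MaskedImaging.thetaMin G ^ 2) *
        ENNReal.ofReal (Real.log L) ≤ (K : ℝ≥0∞)) :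
    1 - 2 * (L : ℝ) ^ (-β) ≤
      P.real {ω |
        MaskedImaging.condNumber
            ((MaskedImaging.stacked G (fun k => φ k ω))ᵀ *
              MaskedImaging.stacked G (fun k => φ k ω)) ≤
          ENNReal.ofReal (1 + δ) / ENNReal.ofReal (1 - δ) *
            ENNReal.ofReal (MaskedImaging.thetaMax G ^ 2 / MaskedImaging.thetaMin G ^ 2)} := by
  open MaskedImaging in
  have hmeas := fun k l => (hφ_law k l).aemeasurable
  exact theorem1_general hG (fun k => aemeasurable_pi_iff.2 (hmeas k))
    (iIndepFun_curry (Y := fun k l ω => φ k ω l) hmeas hφ_indep)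
    (fun k => ae_all_iff.2 fun l => ae_eq_one_or_neg_one_of_hasLaw_rademacher (hφ_law k l))
    (fun k i j hij => integral_mul_eq_zero_of_hasLaw_rademacher (hφ_law k i)
      (hmeas k j).aestronglyMeasurable
      (hφ_indep.indepFun (i := (k, i)) (j := (k, j)) (by simpa using hij))) hδ hK
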